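/- Let $\mathbb Z_+$ be the set of nonnegative integers. For a net $u=\{u_\alpha\}_{\alpha\in\mathbb Z_+^n}$ of real numbers let $\triangle_j u_\alpha = u_{\alpha+\varepsilon_j}-u_\alpha$, where $\varepsilon_j$ is the $j$-th standard unit vector, and for $\beta\in\mathbb Z_+^n$ let $\triangle^\beta=\triangle_1^{\beta_1}\cdots\triangle_n^{\beta_n}$ and $|\beta|=\beta_1+\cdots+\beta_n$. The net $u$ is *joint completely monotone* if $(-1)^{|\beta|}\triangle^\beta u_\alpha\ge 0$ for all $\alpha,\beta\in\mathbb Z_+^n$; for $n=1$ one speaks of a *completely monotone* sequence. A joint completely monotone net $u$ is *minimal* if for every $j=1,\dots,n$ and every $\epsilon>0$ the sequence $\{u_{l\varepsilon_j}-\epsilon\,\mathbb 1_{\{0\}}(l)\}_{l\in\mathbb Z_+}$ is not completely monotone. **Theorem.** Let $k\ge 0$ be an integer, let $a_0,\dots,a_k,b_0,\dots,b_k\in(0,\infty)$, and put $$a(x)=a_0\prod_{j=1}^k(x+a_j),\qquad b(x)=b_0\prod_{j=1}^k(x+b_j)$$ (an empty product is $1$ and an empty sum is $0$). (i) If $b_1\le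 a_1\le b_2\le a_2\le\dots\le b_k\le a_k$, then $\Big\{\dfrac{1}{b(m)+a(m)n}\Big\}_{m,n\in\mathbb Z_+}$ is a minimal joint completely monotone net. (ii) If $\Big\{\dfrac{1}{b(m)+a(m)n}\Big\}_{m,n\in\mathbb Z_+}$ is a joint completely monotone net, then $$\sum_{j=1}^k\frac1{a_j}\le\sum_{j=1}^k\frac1{b_j},\qquad \prod_{j=1}^k b_j\le\prod_{j=1}^k a_j,\qquad \sum_{j=1}^k b_j\le\sum_{j=1}^k a_j;$$ equivalently, for $k\ge1$, the harmonic, geometric and arithmetic means of $(b_1,\dots,b_k)$ are at most the corresponding means of $(a_1,\dots,a_k)$. -/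

import Mathlib

/-- The forward difference operator `△_j` on real nets indexed by `ℤ₊ⁿ`, as a linear operator:
`(△_j u) α = u (α + ε_j) - u α`. -/
def netDiff {n : ℕ} (j : Fin n) : Module.End ℝ ((Fin n → ℕ) → ℝ) where
  toFun u := fun α => u (α + Pi.single j 1) - u α
  map_add' u v := by
    funext α
    simp only [Pi.add_apply]
    ring
  map_smul' c u := by
    funext α
    simp only [Pi.smul_apply, smul_eq_mul, RingHom.id_apply]
    ring

/-- The mixed difference operator `△^β = △_1^{β_1} ⋯ △_n^{β_n}` (the factors commute, so the order
of the composition is immaterial). -/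
def netDiffPow {n : ℕ} (β : Fin n → ℕ) : Module.End ℝ ((Fin n → ℕ) → ℝ) :=
  (List.ofFn fun j => netDiff j ^ β j).prod

/-- Joint complete monotonicity of a net: `(-1)^{|β|} (△^β u) α ≥ 0` for all multi-indices
`α`, `β`. -/
def JointCompletelyMonotone {n : ℕ} (u : (Fin n → ℕ) → ℝ) : Prop :=
  ∀ β α : Fin n → ℕ, 0 ≤ (-1 : ℝ) ^ (∑ j, β j) * netDiffPow β u α

/-- A sequence is completely monotone if it is joint completely monotone as a net over `ℤ₊¹`. -/
def CompletelyMonotoneSeq (u : ℕ → ℝ) : Prop :=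
  JointCompletelyMonotone fun α : Fin 1 → ℕ => u (α 0)

/-- A joint completely monotone net `u` is minimal if for every coordinate `j` and every `ε > 0`
the sequence `k ↦ u (k ε_j) - ε 𝟙_{0}(k)` is not completely monotone. -/
def MinimalJointCompletelyMonotone {n : ℕ} (u : (Fin n → ℕ) → ℝ) : Prop :=
  JointCompletelyMonotone u ∧
    ∀ (j : Fin n) (ε : ℝ), 0 < ε →
      ¬ CompletelyMonotoneSeq fun k => u (Pi.single j k) - ε * ({0} : Set ℕ).indicator 1 k

/-- The polynomial function `x ↦ c ∏_{j=1}^k (x + r_j)`. -/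
def factoredPoly {k : ℕ} (c : ℝ) (r : Fin k → ℝ) (x : ℝ) : ℝ :=
  c * ∏ j, (x + r j)

/-!
Write `r = b / a`, so that the net is `1 / a(m) * 1 / (n + r(m))`. Its `q`-th signed difference in
`n` is `q! / a(m) * ∏_{i ≤ q} 1 / (r(m) + n + i)`, and joint complete monotonicity says precisely
that these sequences in `m` are completely monotone
(`jointCompletelyMonotone_one_div_iff`).

If the roots interlace, then `r` is a constant minus a combination of the functions
`1 / (x + a j)` with nonnegative coefficients (`exists_prod_div_eq_one_sub_sum`). Hence its
increments are completely monotone, so are all reciprocals `1 / (r + t)` (`IsCM.inv`), and complete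
monotonicity is preserved by products. Minimality means that the representing measures of the two
coordinate sequences have no atom at `0`, that is, their `N`-th signed differences at `0` tend to
zero with `N`. This is preserved by division by `l + s` (`tendsto_negDiff_pow_div`).

For the necessary conditions, `r` is shown to increase on the whole half-line `[0, ∞)`, and not
merely along the integers (`prod_div_monotone_of_jointCompletelyMonotone`). A function that is the
Mellin transform of a signed measure on `[0, 1]` and is completely monotone along the integers is
the transform of a positive measure, by Bernstein approximation, and therefore antitone
(`IsMultiplier.antitone_of_isCM`). The functions `1 / a * ∏_{i ≤ q} 1 / (r + n + i)` are of this
kind once `n` is large, by a Neumann series. Letting `q → ∞`, the product dominates the factor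
`1 / a` and `r` has to be monotone. Monotonicity at `0` to first order gives the inequality of
harmonic means; comparison with the limit of `r` at infinity gives
`∏ (x + b j) ≤ ∏ (x + a j)` for all `x ≥ 0`, whence the other two at `x = 0` and `x → ∞`.
-/

open Filter Topology
open scoped unitInterval NNReal

/-! ### Completely monotone sequences -/

/-- The negated forward difference `f m - f (m + 1)`, so that complete monotonicity of `f` says
that all powers of this operator send `f` to nonnegative sequences. -/
def negDiff : Module.End ℝ (ℕ → ℝ) where
  toFun f := fun m => f m - f (m + 1)
  map_add' f g := by
    funext m
    simp only [Pi.add_apply]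
    ring
  map_smul' c f := by
    funext m
    simp only [Pi.smul_apply, smul_eq_mul, RingHom.id_apply]
    ring

theorem negDiff_apply (f : ℕ → ℝ) (m : ℕ) : negDiff f m = f m - f (m + 1) := rfl

theorem negDiff_pow_succ_apply (f : ℕ → ℝ) (N m : ℕ) :
    (negDiff ^ (N + 1)) f m = (negDiff ^ N) f m - (negDiff ^ N) f (m + 1) := by
  rw [pow_succ', Module.End.mul_apply, negDiff_apply]

/-- `f` is completely monotone, expressed through iterates of `negDiff`. -/
def IsCM (f : ℕ → ℝ) : Prop := ∀ N m, 0 ≤ (negDiff ^ N) f m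

/-- The differences of `f` up to order `K` have the signs required by complete monotonicity.
The truncation makes inductive proofs possible for sequences, such as reciprocals, whose
differences are expressed through the sequence itself. -/
def CMUpTo : ℕ → (ℕ → ℝ) → Prop
  | 0, f => ∀ m, 0 ≤ f m
  | K + 1, f => (∀ m, 0 ≤ f m) ∧ CMUpTo K (negDiff f)

theorem isCM_iff_forall_cmUpTo {f : ℕ → ℝ} : IsCM f ↔ ∀ K, CMUpTo K f := by
  constructor
  · intro h K
    induction K generalizing f with
    | zero => exact h 0
    | succ K ih => exact ⟨h 0, ih fun N m => by
        simpa [pow_succ] using h (N + 1) m⟩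
  · intro h N
    induction N generalizing f with
    | zero => exact h 0
    | succ N ih =>
      intro m
      simpa [pow_succ] using ih (fun K => (h (K + 1)).2) m

theorem CMUpTo.of_succ {K : ℕ} {f : ℕ → ℝ} (h : CMUpTo (K + 1) f) : CMUpTo K f := by
  induction K generalizing f with
  | zero => exact h.1
  | succ K ih => exact ⟨h.1, ih h.2⟩

theorem CMUpTo.add {K : ℕ} {f g : ℕ → ℝ} (hf : CMUpTo K f) (hg : CMUpTo K g) :
    CMUpTo K (f + g) := by
  induction K generalizing f g with
  | zero => exact fun m => add_nonneg (hf m) (hg m)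
  | succ K ih =>
    refine ⟨fun m => add_nonneg (hf.1 m) (hg.1 m), ?_⟩
    rw [map_add]
    exact ih hf.2 hg.2

theorem CMUpTo.shift {K : ℕ} {f : ℕ → ℝ} (hf : CMUpTo K f) :
    CMUpTo K (fun m => f (m + 1)) := by
  induction K generalizing f with
  | zero => exact fun m => hf (m + 1)
  | succ K ih => exact ⟨fun m => hf.1 (m + 1), ih hf.2⟩

theorem negDiff_mul (f g : ℕ → ℝ) :
    negDiff (f * g) = negDiff f * g + (fun m => f (m + 1)) * negDiff g := by
  funext m
  simp only [negDiff_apply, Pi.mul_apply, Pi.add_apply]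
  ring

theorem CMUpTo.mul {K : ℕ} {f g : ℕ → ℝ} (hf : CMUpTo K f) (hg : CMUpTo K g) :
    CMUpTo K (f * g) := by
  induction K generalizing f g with
  | zero => exact fun m => mul_nonneg (hf m) (hg m)
  | succ K ih =>
    refine ⟨fun m => mul_nonneg (hf.1 m) (hg.1 m), ?_⟩
    rw [negDiff_mul]
    exact (ih hf.2 hg.of_succ).add (ih hf.of_succ.shift hg.2)

theorem IsCM.add {f g : ℕ → ℝ} (hf : IsCM f) (hg : IsCM g) : IsCM (f + g) := by
  rw [isCM_iff_forall_cmUpTo] at *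
  exact fun K => (hf K).add (hg K)

theorem IsCM.mul {f g : ℕ → ℝ} (hf : IsCM f) (hg : IsCM g) : IsCM (f * g) := by
  rw [isCM_iff_forall_cmUpTo] at *
  exact fun K => (hf K).mul (hg K)

theorem isCM_zero : IsCM 0 := fun N m => by simp

theorem negDiff_const (c : ℝ) : negDiff (fun _ => c) = 0 := by
  funext m
  simp [negDiff_apply]

theorem isCM_const {c : ℝ} (hc : 0 ≤ c) : IsCM fun _ => c := by
  intro N m
  cases N with
  | zero => simpa using hc
  | succ N => simp [pow_succ, negDiff_const]

theorem IsCM.const_mul {f : ℕ → ℝ} (hf : IsCM f) {c : ℝ} (hc : 0 ≤ c) :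
    IsCM fun m => c * f m :=
  (isCM_const hc).mul hf

theorem isCM_negDiff {f : ℕ → ℝ} (hf : IsCM f) : IsCM (negDiff f) := fun N m => by
  simpa [pow_succ] using hf (N + 1) m

theorem isCM_sum {ι : Type*} (s : Finset ι) {f : ι → ℕ → ℝ} (hf : ∀ i ∈ s, IsCM (f i)) :
    IsCM (∑ i ∈ s, f i) :=
  Finset.sum_induction f IsCM (fun _ _ => IsCM.add) isCM_zero hf

theorem isCM_prod {ι : Type*} (s : Finset ι) {f : ι → ℕ → ℝ} (hf : ∀ i ∈ s, IsCM (f i)) :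
    IsCM (∏ i ∈ s, f i) :=
  Finset.prod_induction f IsCM (fun _ _ => IsCM.mul) (isCM_const zero_le_one) hf

/-- The reciprocal of a positive sequence with completely monotone increments is completely
monotone. Since `negDiff f⁻¹ = (-negDiff f) * f⁻¹ * (shift f)⁻¹`, each order of differences of
`f⁻¹` is controlled by the previous one. -/
theorem IsCM.inv {f : ℕ → ℝ} (hpos : ∀ m, 0 < f m) (hf : IsCM (-negDiff f)) :
    IsCM fun m => (f m)⁻¹ := by
  rw [isCM_iff_forall_cmUpTo] at *
  intro K
  induction K with
  | zero => exact fun m => (inv_pos.2 (hpos m)).le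
  | succ K ih =>
    refine ⟨fun m => (inv_pos.2 (hpos m)).le, ?_⟩
    have h : negDiff (fun m => (f m)⁻¹)
        = -negDiff f * (fun m => (f m)⁻¹) * fun m => (f (m + 1))⁻¹ := by
      funext m
      have h1 := (hpos m).ne'
      have h2 := (hpos (m + 1)).ne'
      simp only [negDiff_apply, Pi.mul_apply, Pi.neg_apply]
      field_simp
      ring
    rw [h]
    exact ((hf K).mul ih).mul ih.shift

theorem negDiff_pow_inv_add {r : ℝ} (hr : 0 < r) (q n : ℕ) :
    (negDiff ^ q) (fun l => 1 / ((l : ℝ) + r)) n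
      = q.factorial * ∏ i ∈ Finset.range (q + 1), ((r + n + i : ℝ))⁻¹ := by
  induction q generalizing n with
  | zero => simp [add_comm]
  | succ q ih =>
    have h : ∀ i : ℕ, (r + ((n + 1 : ℕ) : ℝ) + i)⁻¹ = (r + n + ((i + 1 : ℕ) : ℝ))⁻¹ := by
      intro i
      push_cast
      ring
    rw [negDiff_pow_succ_apply, ih, ih,
      (Finset.prod_congr rfl fun i _ => h i :
        ∏ i ∈ Finset.range (q + 1), (r + ((n + 1 : ℕ) : ℝ) + i)⁻¹ = _),
      Finset.prod_range_succ' _ q, Finset.prod_range_succ' _ (q + 1),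
      Finset.prod_range_succ _ q]
    push_cast [Nat.factorial_succ]
    have h1 : r + n + 0 ≠ 0 := by positivity
    have h2 : r + n + (q + 1) ≠ 0 := by positivity
    field_simp
    ring

theorem isCM_inv_add {r : ℝ} (hr : 0 < r) : IsCM fun l => 1 / ((l : ℝ) + r) := fun q n => by
  rw [negDiff_pow_inv_add hr]
  positivity

/-! ### Nets of dimension one and two -/

theorem netDiff_pow_apply {n : ℕ} (j : Fin n) (N : ℕ) (u : (Fin n → ℕ) → ℝ) (α : Fin n → ℕ) :
    (netDiff j ^ N) u α
      = (-1) ^ N * (negDiff ^ N) (fun l => u (Function.update α j l)) (α j) := by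
  induction N generalizing α with
  | zero => simp
  | succ N ih =>
    have h : ∀ l, Function.update (α + Pi.single j 1) j l = Function.update α j l := by
      intro l
      funext i
      by_cases hi : i = j
      · subst hi; simp
      · simp [hi]
    rw [pow_succ', Module.End.mul_apply]
    change (netDiff j ^ N) u (α + Pi.single j 1) - (netDiff j ^ N) u α = _
    rw [ih, ih, negDiff_pow_succ_apply]
    simp only [h, Pi.add_apply, Pi.single_eq_same]
    ring

theorem completelyMonotoneSeq_iff_isCM (f : ℕ → ℝ) : CompletelyMonotoneSeq f ↔ IsCM f := by
  have key : ∀ β α : Fin 1 → ℕ, (-1 : ℝ) ^ (∑ j, β j) *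
      netDiffPow β (fun α : Fin 1 → ℕ => f (α 0)) α = (negDiff ^ (β 0)) f (α 0) := by
    intro β α
    simp only [netDiffPow, List.ofFn_succ, List.ofFn_zero, List.prod_cons, List.prod_nil, mul_one,
      netDiff_pow_apply, Function.update_self, Finset.univ_unique, Finset.sum_singleton,
      Fin.default_eq_zero]
    rw [← mul_assoc, ← mul_pow]
    simp
  constructor
  · intro h N m
    have := h (fun _ => N) (fun _ => m)
    rwa [key] at this
  · intro h β α
    rw [key]
    exact h _ _

/-- For a net in two variables the signed mixed differences are iterated `negDiff`s, first in the
second and then in the first variable. -/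
theorem jointCompletelyMonotone_iff (u : ℕ → ℕ → ℝ) :
    (JointCompletelyMonotone fun α : Fin 2 → ℕ => u (α 0) (α 1)) ↔
      ∀ q n, IsCM fun m => (negDiff ^ q) (u m) n := by
  have key : ∀ β α : Fin 2 → ℕ, (-1 : ℝ) ^ (∑ j, β j) *
      netDiffPow β (fun α : Fin 2 → ℕ => u (α 0) (α 1)) α
        = (negDiff ^ (β 0)) (fun m => (negDiff ^ (β 1)) (u m) (α 1)) (α 0) := by
    intro β α
    have h : netDiffPow β = netDiff 0 ^ β 0 * netDiff 1 ^ β 1 := by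
      simp [netDiffPow, List.ofFn_succ]
    have h2 : (fun l => (netDiff 1 ^ β 1) (fun α : Fin 2 → ℕ => u (α 0) (α 1))
        (Function.update α 0 l))
        = (-1 : ℝ) ^ β 1 • fun m => (negDiff ^ (β 1)) (u m) (α 1) := by
      funext l
      rw [netDiff_pow_apply]
      simp
    rw [h, Module.End.mul_apply, netDiff_pow_apply, h2, map_smul, Fin.sum_univ_two, Pi.smul_apply,
      smul_eq_mul, ← mul_assoc, ← mul_assoc, ← pow_add, ← pow_add]
    have : Even (β 0 + β 1 + β 0 + β 1) := ⟨β 0 + β 1, by ring⟩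
    rw [this.neg_one_pow, one_mul]
  constructor
  · intro h q n N m
    have := h ![N, q] ![m, n]
    rwa [key] at this
  · intro h β α
    rw [key]
    exact h _ _ _ _

/-! ### Interlacing roots -/

/-- Partial fractions of a quotient of polynomials with interlacing roots: all residues are
nonpositive. Each new factor `(x + b) / (x + a)` with `a i ≤ b ≤ a` turns `1 / (x + a i)` into a
convex combination of `1 / (x + a i)` and `1 / (x + a)`. -/
theorem exists_prod_div_eq_one_sub_sum {k : ℕ} (a b : Fin k → ℝ) (ha : ∀ j, 0 < a j)
    (hba : ∀ j, b j ≤ a j) (hab : ∀ i j, i < j → a i ≤ b j) :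
    ∃ c : Fin k → ℝ, (∀ j, 0 ≤ c j) ∧
      ∀ x : ℝ, 0 ≤ x → ∏ j, (x + b j) / (x + a j) = 1 - ∑ j, c j * (1 / (x + a j)) := by
  induction k with
  | zero => exact ⟨0, fun _ => le_rfl, by simp⟩
  | succ k ih =>
    obtain ⟨c, hc, h⟩ := ih (fun j => a j.castSucc) (fun j => b j.castSucc) (fun j => ha _)
      (fun j => hba _) (fun i j hij => hab _ _ (Fin.castSucc_lt_castSucc_iff.2 hij))
    set A := a (Fin.last k) with hA
    set B := b (Fin.last k) with hB
    have hBA : B ≤ A := hba _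
    have hApos : 0 < A := ha _
    have hcB : ∀ j : Fin k, a j.castSucc ≤ B := fun j => hab _ _ (Fin.castSucc_lt_last j)
    have hw : ∀ j : Fin k, ∃ w : ℝ, 0 ≤ w ∧ w ≤ 1 ∧ w * A + (1 - w) * a j.castSucc = B := by
      intro j
      have hmem : B ∈ segment ℝ (a j.castSucc) A := by
        rw [segment_eq_Icc ((hcB j).trans hBA)]
        exact ⟨hcB j, hBA⟩
      obtain ⟨s, t, hs, ht, hst, hB⟩ := hmem
      refine ⟨t, ht, by linarith, ?_⟩
      rw [← hst, add_sub_cancel_right, add_comm]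
      exact hB
    choose w hw0 hw1 hw using hw
    refine ⟨Fin.snoc (fun j => c j * w j) (A - B + ∑ j, c j * (1 - w j)), ?_, ?_⟩
    · intro j
      refine Fin.lastCases ?_ (fun j => ?_) j
      · rw [Fin.snoc_last]
        exact add_nonneg (sub_nonneg.2 hBA)
          (Finset.sum_nonneg fun j _ => mul_nonneg (hc j) (sub_nonneg.2 (hw1 j)))
      · rw [Fin.snoc_castSucc]
        exact mul_nonneg (hc j) (hw0 j)
    · intro x hx
      rw [Fin.prod_univ_castSucc, Fin.sum_univ_castSucc, h x hx]
      simp only [Fin.snoc_castSucc, Fin.snoc_last]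
      rw [← hA, ← hB, add_mul, Finset.sum_mul, sub_mul, Finset.sum_mul]
      have hterm : ∀ j : Fin k, c j * (1 / (x + a j.castSucc)) * ((x + B) / (x + A))
          = c j * w j * (1 / (x + a j.castSucc)) + c j * (1 - w j) * (1 / (x + A)) := by
        intro j
        have h1 : x + a j.castSucc ≠ 0 := (add_pos_of_nonneg_of_pos hx (ha _)).ne'
        have h2 : x + A ≠ 0 := (add_pos_of_nonneg_of_pos hx hApos).ne'
        rw [← hw j]
        field_simp
        ring
      rw [Finset.sum_congr rfl fun j _ => hterm j, Finset.sum_add_distrib]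
      have h2 : x + A ≠ 0 := (add_pos_of_nonneg_of_pos hx hApos).ne'
      have h3 : (x + B) / (x + A) = 1 - (A - B) * (1 / (x + A)) := by
        field_simp
        ring
      rw [h3]
      ring

/-! ### Mass at the origin -/

/-- If `g` is completely monotone with no mass at the origin, in the sense that
`negDiff ^ N g 0 → 0`, then so is `g / (l + s)`. The differences `d N` of the quotient `h`
satisfy `s * d (N + 1) = (N + 1) * (d N - d (N + 1)) + e (N + 1)`, where `e` are those of `g`; a
positive limit of `d` would make the telescoping series of `d N - d (N + 1)` comparable to the
harmonic series. -/
theorem tendsto_negDiff_pow_div {g : ℕ → ℝ} (hg : IsCM g)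
    (hlim : Tendsto (fun N => (negDiff ^ N) g 0) atTop (𝓝 0)) {s : ℝ} (hs : 0 < s) :
    Tendsto (fun N => (negDiff ^ N) (fun l => g l * (1 / ((l : ℝ) + s))) 0) atTop (𝓝 0) := by
  set h : ℕ → ℝ := fun l => g l * (1 / ((l : ℝ) + s)) with hh
  have hcm : IsCM h := hg.mul (isCM_inv_add hs)
  have hgh : g = fun l => (l + s) * h l := by
    funext l
    have : (l : ℝ) + s ≠ 0 := by positivity
    simp only [hh]
    field_simp
  have hrec : ∀ N l : ℕ, (negDiff ^ (N + 1)) g l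
      = (l + s) * (negDiff ^ (N + 1)) h l - (N + 1) * (negDiff ^ N) h (l + 1) := by
    intro N
    induction N with
    | zero =>
      intro l
      rw [hgh]
      simp only [zero_add, pow_one, pow_zero, negDiff_apply, Module.End.one_apply]
      push_cast
      ring
    | succ N ih =>
      intro l
      rw [negDiff_pow_succ_apply, ih, ih, negDiff_pow_succ_apply h (N + 1) l,
        negDiff_pow_succ_apply h N (l + 1)]
      push_cast
      ring
  set d : ℕ → ℝ := fun N => (negDiff ^ N) h 0 with hd
  have hstep : ∀ N, d N - d (N + 1) = (negDiff ^ N) h 1 := by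
    intro N
    simp only [hd, negDiff_pow_succ_apply]
    ring
  have hanti : Antitone d := antitone_nat_of_succ_le fun N => by
    have := hcm N 1
    rw [← hstep] at this
    linarith
  have hbdd : BddBelow (Set.range d) := ⟨0, by rintro _ ⟨N, rfl⟩; exact hcm N 0⟩
  obtain ⟨L, hL⟩ : ∃ L, Tendsto d atTop (𝓝 L) := ⟨_, tendsto_atTop_ciInf hanti hbdd⟩
  have hL0 : 0 ≤ L := ge_of_tendsto' hL fun N => hcm N 0
  rcases hL0.eq_or_lt with h0 | hpos
  · rwa [← h0] at hL
  exfalso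
  have hsL : 0 < s * L := mul_pos hs hpos
  have hmul : Tendsto (fun N : ℕ => ((N : ℝ) + 1) * (d N - d (N + 1))) atTop (𝓝 (s * L)) := by
    have h1 : Tendsto (fun N => s * d (N + 1) - (negDiff ^ (N + 1)) g 0) atTop
        (𝓝 (s * L - 0)) :=
      ((hL.comp (tendsto_add_atTop_nat 1)).const_mul s).sub
        (hlim.comp (tendsto_add_atTop_nat 1))
    rw [sub_zero] at h1
    refine h1.congr fun N => ?_
    have := hrec N 0
    rw [hstep, this]
    simp only [hd]
    push_cast
    ring
  have hsum : Summable fun N => d N - d (N + 1) := by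
    have hnn : ∀ N, 0 ≤ d N - d (N + 1) := fun N => sub_nonneg.2 (hanti N.le_succ)
    refine summable_of_sum_range_le (c := d 0) hnn fun n => ?_
    rw [Finset.sum_range_sub']
    linarith [show 0 ≤ d n from hcm n 0]
  have hev : ∀ᶠ N : ℕ in atTop, s * L / 2 * (1 / ((N : ℝ) + 1)) ≤ d N - d (N + 1) := by
    filter_upwards [hmul.eventually (lt_mem_nhds (half_lt_self hsL))] with N hN
    have : (0 : ℝ) < (N : ℝ) + 1 := by positivity
    rw [mul_one_div, div_le_iff₀ this]
    linarith
  have hharm : Summable fun N : ℕ => s * L / 2 * (1 / ((N : ℝ) + 1)) := by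
    refine hsum.of_norm_bounded_eventually_nat ?_
    filter_upwards [hev] with N hN
    rw [Real.norm_of_nonneg (by positivity)]
    exact hN
  rw [summable_mul_left_iff (by positivity)] at hharm
  have := (summable_nat_add_iff (f := fun n : ℕ => 1 / (n : ℝ)) 1).1 (by simpa using hharm)
  exact Real.not_summable_one_div_natCast this

theorem tendsto_negDiff_pow_prod {k : ℕ} {c : ℝ} (hc : 0 ≤ c) (b : Fin k → ℝ)
    (hb : ∀ j, 0 < b j) :
    Tendsto (fun N => (negDiff ^ N) (fun l : ℕ => c * ∏ j, (1 / ((l : ℝ) + b j))) 0)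
      atTop (𝓝 0) := by
  induction k with
  | zero =>
    refine tendsto_const_nhds.congr' ?_
    filter_upwards [eventually_ge_atTop 1] with N hN
    obtain ⟨N, rfl⟩ := Nat.exists_eq_add_of_le' hN
    simp [pow_succ, negDiff_const]
  | succ k ih =>
    have hcm : IsCM fun l : ℕ => c * ∏ j : Fin k, (1 / ((l : ℝ) + b j.castSucc)) := by
      have := (isCM_prod Finset.univ fun j _ => isCM_inv_add (hb (Fin.castSucc j))).const_mul hc
      simpa only [Finset.prod_apply] using this
    simpa only [Fin.prod_univ_castSucc, mul_assoc] using
      tendsto_negDiff_pow_div hcm (ih _ fun j => hb _) (hb (Fin.last k))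

/-- The sequence `𝟙_{0}` is fixed by `negDiff`, so subtracting a multiple of it from a sequence
without mass at the origin destroys complete monotonicity. -/
theorem not_isCM_sub_indicator {f : ℕ → ℝ}
    (hf : Tendsto (fun N => (negDiff ^ N) f 0) atTop (𝓝 0)) {ε : ℝ} (hε : 0 < ε) :
    ¬ IsCM fun l => f l - ε * ({0} : Set ℕ).indicator 1 l := by
  intro h
  have hfix : ∀ N, (negDiff ^ N) (({0} : Set ℕ).indicator (1 : ℕ → ℝ))
      = ({0} : Set ℕ).indicator 1 := by
    intro N
    induction N with
    | zero => simp
    | succ N ih =>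
      funext m
      rw [negDiff_pow_succ_apply, ih]
      simp [Set.indicator_apply]
  have hle : ∀ N, ε ≤ (negDiff ^ N) f 0 := by
    intro N
    have h1 := h N 0
    have h2 : (fun l => f l - ε * ({0} : Set ℕ).indicator 1 l)
        = f - ε • ({0} : Set ℕ).indicator (1 : ℕ → ℝ) := rfl
    rw [h2, map_sub, map_smul, hfix] at h1
    simp at h1
    exact h1
  exact hε.not_ge (ge_of_tendsto' hf hle)

/-! ### Multipliers of powers on `C([0, 1])` -/

/-- The function `t ↦ t ^ x` on `[0, 1]`, with `0 ^ 0 = 1`. -/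
noncomputable def powMap (x : ℝ≥0) : C(I, ℝ) where
  toFun t := (t : ℝ) ^ (x : ℝ)
  continuous_toFun := continuous_subtype_val.rpow_const fun _ => Or.inr x.2

theorem powMap_apply (x : ℝ≥0) (t : I) : powMap x t = (t : ℝ) ^ (x : ℝ) := rfl

/-- `φ` is a multiplier if some bounded operator on `C([0, 1])` has every power `t ^ x` as an
eigenvector, with eigenvalue `φ x`. Evaluating the operator at `t = 1` shows that `φ` is the
Mellin transform `x ↦ ∫ t ^ x dμ(t)` of a signed measure on `[0, 1]`; operators rather than
measures are used because they compose and can be inverted by a Neumann series. -/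
def IsMultiplier (φ : ℝ≥0 → ℝ) : Prop :=
  ∃ T : C(I, ℝ) →L[ℝ] C(I, ℝ), ∀ x, T (powMap x) = φ x • powMap x

theorem isMultiplier_const (c : ℝ) : IsMultiplier fun _ => c :=
  ⟨c • ContinuousLinearMap.id ℝ _, fun x => by simp⟩

theorem IsMultiplier.add {φ ψ : ℝ≥0 → ℝ} (hφ : IsMultiplier φ) (hψ : IsMultiplier ψ) :
    IsMultiplier fun x => φ x + ψ x := by
  obtain ⟨S, hS⟩ := hφ
  obtain ⟨T, hT⟩ := hψ
  exact ⟨S + T, fun x => by simp [hS, hT, add_smul]⟩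

theorem IsMultiplier.mul {φ ψ : ℝ≥0 → ℝ} (hφ : IsMultiplier φ) (hψ : IsMultiplier ψ) :
    IsMultiplier fun x => φ x * ψ x := by
  obtain ⟨S, hS⟩ := hφ
  obtain ⟨T, hT⟩ := hψ
  exact ⟨T.comp S, fun x => by simp [hS, hT, mul_smul]⟩

theorem isMultiplier_prod {ι : Type*} (s : Finset ι) {φ : ι → ℝ≥0 → ℝ}
    (hφ : ∀ i ∈ s, IsMultiplier (φ i)) : IsMultiplier fun x => ∏ i ∈ s, φ i x := by
  have := Finset.prod_induction φ IsMultiplier (fun _ _ => IsMultiplier.mul)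
    (isMultiplier_const 1) hφ
  simpa only [Finset.prod_fn] using this

/-- The operator `f ↦ (s ↦ ∫ f (s * ψ v) dv)` averaging the dilations of `f` by the values
of `ψ`. -/
noncomputable def dilationAverage (ψ : C(I, I)) : C(I, ℝ) →L[ℝ] C(I, ℝ) :=
  have hcont (f : C(I, ℝ)) : Continuous fun p : I × I => f (p.1 * ψ p.2) := by fun_prop
  have hint (f : C(I, ℝ)) (s : I) : MeasureTheory.Integrable fun v : I => f (s * ψ v) :=
    ((hcont f).comp (Continuous.prodMk_right s)).integrable_of_hasCompactSupport
      (HasCompactSupport.of_compactSpace _)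
  LinearMap.mkContinuous
    { toFun := fun f => ⟨fun s => ∫ v : I, f (s * ψ v), by
        simpa using continuous_parametric_integral_of_continuous
          (μ := (MeasureTheory.volume : MeasureTheory.Measure I))
          (f := fun s v => f (s * ψ v)) (hcont f) isCompact_univ⟩
      map_add' := fun f g => by
        ext s
        exact MeasureTheory.integral_add (hint f s) (hint g s)
      map_smul' := fun c f => by
        ext s
        exact MeasureTheory.integral_const_mul c _ }
    1 fun f => by
      rw [one_mul, ContinuousMap.norm_le _ (norm_nonneg f)]
      intro s
      simpa using MeasureTheory.norm_integral_le_of_norm_le_const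
        (μ := (MeasureTheory.volume : MeasureTheory.Measure I))
        (Eventually.of_forall fun v : I => f.norm_coe_le_norm (s * ψ v))

theorem dilationAverage_apply (ψ : C(I, I)) (f : C(I, ℝ)) (s : I) :
    dilationAverage ψ f s = ∫ v : I, f (s * ψ v) := rfl

/-- `1 / (x + a)` is the Mellin transform of `t ^ (a - 1) dt`; the substitution `t = v ^ (1 / a)`
turns the corresponding operator into an unweighted average of dilations. -/
theorem isMultiplier_inv_add {a : ℝ} (ha : 0 < a) :
    IsMultiplier fun x => 1 / ((x : ℝ) + a) := by
  let ψ : C(I, I) :=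
    { toFun := fun v => ⟨(v : ℝ) ^ (1 / a), Real.rpow_nonneg v.2.1 _,
        Real.rpow_le_one v.2.1 v.2.2 (by positivity)⟩
      continuous_toFun := Continuous.subtype_mk
        (continuous_subtype_val.rpow_const fun _ => Or.inr (by positivity)) _ }
  refine ⟨(1 / a) • dilationAverage ψ, fun x => ?_⟩
  ext s
  have hx : 0 ≤ 1 / a * (x : ℝ) := by positivity
  have h : ∫ v : I, ((v : ℝ) ^ (1 / a * (x : ℝ))) = 1 / (1 / a * x + 1) := by
    rw [MeasureTheory.integral_subtype measurableSet_Icc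
      (fun v : ℝ => v ^ (1 / a * (x : ℝ))), MeasureTheory.integral_Icc_eq_integral_Ioc,
      ← intervalIntegral.integral_of_le zero_le_one,
      integral_rpow (Or.inl (by linarith)), Real.one_rpow,
      Real.zero_rpow (by positivity), sub_zero]
  have h2 : ∀ v : I, powMap x (s * ψ v)
      = (s : ℝ) ^ (x : ℝ) * (v : ℝ) ^ (1 / a * (x : ℝ)) := by
    intro v
    rw [powMap_apply, Set.Icc.coe_mul, show (ψ v : ℝ) = (v : ℝ) ^ (1 / a) from rfl,
      Real.mul_rpow s.2.1 (Real.rpow_nonneg v.2.1 _),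
      ← Real.rpow_mul v.2.1]
  rw [smul_apply, ContinuousMap.smul_apply, ContinuousMap.smul_apply,
    dilationAverage_apply, smul_eq_mul, smul_eq_mul, powMap_apply]
  simp only [h2]
  rw [MeasureTheory.integral_const_mul, h]
  have : (x : ℝ) + a ≠ 0 := by positivity
  field_simp

/-- For large constants `c` the operator with eigenvalues `φ x + c` is invertible. -/
theorem IsMultiplier.eventually_inv_add {φ : ℝ≥0 → ℝ} (hφ : IsMultiplier φ)
    (hφ0 : ∀ x, 0 < φ x) : ∃ C : ℝ, ∀ c, C ≤ c → IsMultiplier fun x => (φ x + c)⁻¹ := by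
  obtain ⟨T, hT⟩ := hφ
  refine ⟨‖T‖ + 1, fun c hc => ?_⟩
  have hc0 : 0 < c := lt_of_lt_of_le (by positivity) hc
  have hu : IsUnit (algebraMap ℝ (C(I, ℝ) →L[ℝ] C(I, ℝ)) c - -T) := by
    refine spectrum.mem_resolventSet_of_norm_lt (𝕜 := ℝ) (A := C(I, ℝ) →L[ℝ] C(I, ℝ))
      ((norm_neg T).trans_lt ?_)
    rw [Real.norm_of_nonneg hc0.le]
    linarith
  obtain ⟨u, hu⟩ := hu
  refine ⟨(↑u⁻¹ : C(I, ℝ) →L[ℝ] C(I, ℝ)), fun x => ?_⟩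
  have h1 : (u : C(I, ℝ) →L[ℝ] C(I, ℝ)) (powMap x) = (φ x + c) • powMap x := by
    rw [hu, Algebra.algebraMap_eq_smul_one]
    simp [hT, add_smul, add_comm]
  have h2 : (↑u⁻¹ : C(I, ℝ) →L[ℝ] C(I, ℝ)) ((u : C(I, ℝ) →L[ℝ] C(I, ℝ)) (powMap x))
      = powMap x := by
    change (↑u⁻¹ * ↑u : C(I, ℝ) →L[ℝ] C(I, ℝ)) (powMap x) = powMap x
    rw [u.inv_mul]
    rfl
  rw [h1, map_smul] at h2
  rw [eq_inv_smul_iff₀ (add_pos (hφ0 x) hc0).ne']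
  exact h2

/-- Bernstein approximation turns complete monotonicity of `φ` on the integers into positivity of
the functional `f ↦ T f 1`, which is then applied to `t ^ x - t ^ y ≥ 0`. -/
theorem IsMultiplier.antitone_of_isCM {φ : ℝ≥0 → ℝ} (hφ : IsMultiplier φ)
    (hcm : IsCM fun m => φ m) : Antitone φ := by
  obtain ⟨T, hT⟩ := hφ
  have hT1 : ∀ x, T (powMap x) 1 = φ x := fun x => by simp [hT, powMap_apply]
  have hmono : ∀ N m : ℕ, T (powMap m * (1 - powMap 1) ^ N) 1 = (negDiff ^ N) (fun m => φ m) m := by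
    intro N
    induction N with
    | zero => intro m; simp [hT1]
    | succ N ih =>
      intro m
      have : powMap m * (1 - powMap 1) ^ (N + 1)
          = powMap m * (1 - powMap 1) ^ N - powMap ((m + 1 : ℕ) : ℝ≥0) * (1 - powMap 1) ^ N := by
        ext t
        simp only [ContinuousMap.mul_apply, ContinuousMap.sub_apply, ContinuousMap.pow_apply,
          ContinuousMap.one_apply, powMap_apply, NNReal.coe_natCast, Real.rpow_natCast,
          NNReal.coe_one, Real.rpow_one]
        ring
      rw [this, map_sub, ContinuousMap.sub_apply, ih, ih, negDiff_pow_succ_apply]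
  have hbern : ∀ n ν : ℕ, 0 ≤ T (bernstein n ν) 1 := by
    intro n ν
    have : bernstein n ν = (n.choose ν : ℝ) • (powMap ν * (1 - powMap 1) ^ (n - ν)) := by
      ext t
      simp [bernstein_apply, powMap_apply, mul_assoc]
    rw [this, map_smul, ContinuousMap.smul_apply, hmono]
    exact smul_nonneg (Nat.cast_nonneg _) (hcm _ _)
  have hpos : ∀ f : C(I, ℝ), (∀ t, 0 ≤ f t) → 0 ≤ T f 1 := by
    intro f hf
    have hlim : Tendsto (fun n => T (bernsteinApproximation n f) 1) atTop (𝓝 (T f 1)) :=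
      ((continuous_eval_const (F := C(I, ℝ)) (1 : I)).comp T.continuous).continuousAt.tendsto.comp
        (bernsteinApproximation_uniform f)
    refine ge_of_tendsto' hlim fun n => ?_
    rw [bernsteinApproximation, map_sum, ContinuousMap.sum_apply]
    refine Finset.sum_nonneg fun k _ => ?_
    have : bernstein n k • ContinuousMap.const I (f (bernstein.z k))
        = f (bernstein.z k) • bernstein n k := by
      ext t
      simp [mul_comm]
    rw [this, map_smul, ContinuousMap.smul_apply]
    exact smul_nonneg (hf _) (hbern n k)
  intro x y hxy
  have := hpos (powMap x - powMap y) fun t => by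
    rw [ContinuousMap.sub_apply, sub_nonneg, powMap_apply, powMap_apply]
    exact Real.rpow_le_rpow_of_exponent_ge' t.2.1 t.2.2 x.2 hxy
  rw [map_sub, ContinuousMap.sub_apply, hT1, hT1] at this
  linarith

/-! ### Comparison of products -/

theorem one_add_sum_range_le_prod {f : ℕ → ℝ} (hf : ∀ i, 0 ≤ f i) (q : ℕ) :
    1 + ∑ i ∈ Finset.range q, f i ≤ ∏ i ∈ Finset.range q, (1 + f i) := by
  induction q with
  | zero => simp
  | succ q ih =>
    rw [Finset.sum_range_succ, Finset.prod_range_succ]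
    have h1 := mul_le_mul_of_nonneg_right ih (add_nonneg zero_le_one (hf q))
    have h2 := mul_nonneg (Finset.sum_nonneg fun i (_ : i ∈ Finset.range q) => hf i) (hf q)
    nlinarith

/-- If `s < r` then `∏ (r + i) / (s + i)` diverges with the harmonic series, so a comparison of
the inverse rising factorials up to constants forces `r ≤ s`. -/
theorem le_of_forall_prod_inv_le {r s A B : ℝ} (hs : 0 < s) (hB : 0 < B)
    (h : ∀ q : ℕ, B * ∏ i ∈ Finset.range (q + 1), (s + i)⁻¹
      ≤ A * ∏ i ∈ Finset.range (q + 1), (r + i)⁻¹) : r ≤ s := by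
  by_contra! hlt
  have hδ : 0 < r - s := sub_pos.2 hlt
  have hsi : ∀ i : ℕ, 0 < s + i := fun i => by positivity
  have hri : ∀ i : ℕ, 0 < r + i := fun i => by linarith [hsi i]
  have hf : ∀ i : ℕ, 0 ≤ (r - s) * (1 / |(i : ℝ) + s| ^ (1 : ℝ)) := fun i => by positivity
  have hsum : Summable fun i : ℕ => (r - s) * (1 / |(i : ℝ) + s| ^ (1 : ℝ)) := by
    refine summable_of_sum_range_le (c := A / B) hf fun q => ?_
    have h1 : ∏ i ∈ Finset.range (q + 1), (1 + (r - s) * (1 / |(i : ℝ) + s| ^ (1 : ℝ)))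
        = (∏ i ∈ Finset.range (q + 1), (s + i)⁻¹) * ∏ i ∈ Finset.range (q + 1), (r + i) := by
      rw [← Finset.prod_mul_distrib]
      refine Finset.prod_congr rfl fun i _ => ?_
      have := hsi i
      rw [add_comm (i : ℝ) s, abs_of_pos this, Real.rpow_one]
      field_simp
      ring
    have h2 : (∏ i ∈ Finset.range (q + 1), (r + i)⁻¹) * ∏ i ∈ Finset.range (q + 1), (r + i)
        = 1 := by
      rw [← Finset.prod_mul_distrib]
      exact Finset.prod_eq_one fun i _ => inv_mul_cancel₀ (hri i).ne'
    have h3 : 0 ≤ ∏ i ∈ Finset.range (q + 1), (r + i : ℝ) :=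
      Finset.prod_nonneg fun i _ => (hri i).le
    have h4 := mul_le_mul_of_nonneg_right (h q) h3
    rw [mul_assoc, mul_assoc, ← h1, h2, mul_one] at h4
    have h5 := one_add_sum_range_le_prod hf (q + 1)
    rw [Finset.sum_range_succ] at h5
    rw [le_div_iff₀' hB]
    refine le_trans (mul_le_mul_of_nonneg_left ?_ hB.le) h4
    linarith [hf q]
  rw [summable_mul_left_iff hδ.ne', Real.summable_one_div_nat_add_rpow] at hsum
  exact lt_irrefl _ hsum

theorem sum_le_sum_of_prod_one_add_mul_le {k : ℕ} {p q : Fin k → ℝ}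
    (h : ∀ y : ℝ, 0 < y → ∏ j, (1 + p j * y) ≤ ∏ j, (1 + q j * y)) :
    ∑ j, p j ≤ ∑ j, q j := by
  have hder : ∀ p : Fin k → ℝ,
      HasDerivAt (fun y : ℝ => ∏ j, (1 + p j * y)) (∑ j, p j) 0 := by
    intro p
    have := HasDerivAt.fun_finsetProd (u := Finset.univ) (x := (0 : ℝ))
      (f := fun j y => 1 + p j * y) (f' := p) fun j _ => by
        simpa using ((hasDerivAt_id (0 : ℝ)).const_mul (p j)).const_add 1
    simpa using this
  have hlim := ((hder q).sub (hder p)).tendsto_slope_zero_right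
  rw [← sub_nonneg]
  refine ge_of_tendsto hlim ?_
  filter_upwards [self_mem_nhdsWithin] with y hy
  have hy : 0 < y := hy
  have := h y hy
  simp only [Pi.sub_apply, zero_add, smul_eq_mul, mul_zero, add_zero, Finset.prod_const_one,
    sub_self, sub_zero]
  exact mul_nonneg (inv_nonneg.2 hy.le) (sub_nonneg.2 this)

/-! ### The net of reciprocals -/

theorem factoredPoly_pos {k : ℕ} {c : ℝ} (hc : 0 < c) {r : Fin k → ℝ} (hr : ∀ j, 0 < r j)
    {x : ℝ} (hx : 0 ≤ x) : 0 < factoredPoly c r x :=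
  mul_pos hc (Finset.prod_pos fun j _ => add_pos_of_nonneg_of_pos hx (hr j))

theorem one_div_factoredPoly {k : ℕ} (c : ℝ) (r : Fin k → ℝ) (x : ℝ) :
    1 / factoredPoly c r x = 1 / c * ∏ j, (1 / (x + r j)) := by
  simp only [factoredPoly, one_div, mul_inv, Finset.prod_inv_distrib]

theorem factoredPoly_div {k : ℕ} (c d : ℝ) (r s : Fin k → ℝ) (x : ℝ) :
    factoredPoly c r x / factoredPoly d s x = c / d * ∏ j, (x + r j) / (x + s j) := by
  simp only [factoredPoly, Finset.prod_div_distrib, mul_div_mul_comm]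

theorem negDiff_pow_one_div_affine {A B : ℝ} (hA : 0 < A) (hB : 0 < B) (q n : ℕ) :
    (negDiff ^ q) (fun n : ℕ => 1 / (B + A * n)) n
      = q.factorial * (1 / A * ∏ i ∈ Finset.range (q + 1), (B / A + n + i)⁻¹) := by
  have h : (fun n : ℕ => 1 / (B + A * n)) = (1 / A) • fun n : ℕ => 1 / ((n : ℝ) + B / A) := by
    funext n
    have h1 : B + A * n ≠ 0 := by positivity
    have h2 : (n : ℝ) + B / A ≠ 0 := by positivity
    simp only [Pi.smul_apply, smul_eq_mul]
    field_simp
    ring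
  rw [h, map_smul, Pi.smul_apply, negDiff_pow_inv_add (div_pos hB hA), smul_eq_mul]
  ring

/-- Complete monotonicity in the second variable can be made explicit, leaving a family of
conditions on sequences in the first variable. -/
theorem jointCompletelyMonotone_one_div_iff {A B : ℕ → ℝ} (hA : ∀ m, 0 < A m)
    (hB : ∀ m, 0 < B m) :
    (JointCompletelyMonotone fun α : Fin 2 → ℕ => 1 / (B (α 0) + A (α 0) * (α 1))) ↔
      ∀ q n : ℕ, IsCM fun m =>
        1 / A m * ∏ i ∈ Finset.range (q + 1), (B m / A m + n + i)⁻¹ := by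
  rw [jointCompletelyMonotone_iff fun m n => 1 / (B m + A m * n)]
  refine forall_congr' fun q => forall_congr' fun n => ?_
  simp only [fun m => negDiff_pow_one_div_affine (hA m) (hB m) q n]
  refine ⟨fun h => ?_, fun h => h.const_mul (Nat.cast_nonneg _)⟩
  have := h.const_mul (c := (q.factorial : ℝ)⁻¹) (by positivity)
  have hq : (q.factorial : ℝ) ≠ 0 := Nat.cast_ne_zero.2 q.factorial_ne_zero
  simpa only [inv_mul_cancel_left₀ hq] using this

theorem le_of_lt_of_interlacing {k : ℕ} {a b : Fin k → ℝ} (hba : ∀ j, b j ≤ a j)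
    (hab : ∀ i j : Fin k, (i : ℕ) + 1 = (j : ℕ) → a i ≤ b j) {i j : Fin k} (hij : i < j) :
    a i ≤ b j := by
  obtain ⟨j, hj⟩ := j
  induction j with
  | zero => exact absurd hij (Nat.not_lt_zero _)
  | succ j ih =>
    have hle : (i : ℕ) ≤ j := Nat.lt_succ_iff.1 hij
    rcases hle.eq_or_lt with h | h
    · exact hab _ _ (by simp [h])
    · have hj' : j < k := j.lt_succ_self.trans hj
      exact (ih hj' h).trans ((hba _).trans (hab ⟨j, hj'⟩ _ rfl))

theorem isCM_inv_factoredPoly_div_add {k : ℕ} {a₀ b₀ : ℝ} (ha₀ : 0 < a₀) (hb₀ : 0 < b₀)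
    {a b : Fin k → ℝ} (ha : ∀ j, 0 < a j) (hb : ∀ j, 0 < b j) (hba : ∀ j, b j ≤ a j)
    (hab : ∀ i j : Fin k, (i : ℕ) + 1 = (j : ℕ) → a i ≤ b j) {t : ℝ} (ht : 0 ≤ t) :
    IsCM fun m : ℕ => (factoredPoly b₀ b m / factoredPoly a₀ a m + t)⁻¹ := by
  refine IsCM.inv (fun m => add_pos_of_pos_of_nonneg (div_pos
    (factoredPoly_pos hb₀ hb m.cast_nonneg) (factoredPoly_pos ha₀ ha m.cast_nonneg)) ht) ?_
  obtain ⟨c, hc, h⟩ := exists_prod_div_eq_one_sub_sum a b ha hba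
    fun i j => le_of_lt_of_interlacing hba hab
  have hcm : IsCM (∑ j, fun m : ℕ => b₀ / a₀ * c j * (1 / ((m : ℝ) + a j))) :=
    isCM_sum _ fun j _ => (isCM_inv_add (ha j)).const_mul
      (mul_nonneg (div_pos hb₀ ha₀).le (hc j))
  convert isCM_negDiff hcm using 1
  funext m
  simp only [Pi.neg_apply, negDiff_apply, factoredPoly_div, h _ (Nat.cast_nonneg _),
    Finset.sum_apply, mul_assoc, ← Finset.mul_sum]
  ring

theorem minimalJointCompletelyMonotone_of_interlacing {k : ℕ} {a₀ b₀ : ℝ} (ha₀ : 0 < a₀)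
    (hb₀ : 0 < b₀) {a b : Fin k → ℝ} (ha : ∀ j, 0 < a j) (hb : ∀ j, 0 < b j)
    (hba : ∀ j, b j ≤ a j) (hab : ∀ i j : Fin k, (i : ℕ) + 1 = (j : ℕ) → a i ≤ b j) :
    MinimalJointCompletelyMonotone fun α : Fin 2 → ℕ =>
      1 / (factoredPoly b₀ b (α 0) + factoredPoly a₀ a (α 0) * (α 1)) := by
  have hApos : ∀ m : ℕ, 0 < factoredPoly a₀ a m := fun m =>
    factoredPoly_pos ha₀ ha m.cast_nonneg
  have hBpos : ∀ m : ℕ, 0 < factoredPoly b₀ b m := fun m =>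
    factoredPoly_pos hb₀ hb m.cast_nonneg
  refine ⟨?_, fun j ε hε => ?_⟩
  · rw [jointCompletelyMonotone_one_div_iff hApos hBpos]
    intro q n
    have h1 : IsCM fun m : ℕ => 1 / factoredPoly a₀ a m := by
      have := (isCM_prod Finset.univ fun j _ => isCM_inv_add (ha j)).const_mul
        (one_div_pos.2 ha₀).le
      simpa only [one_div_factoredPoly, Finset.prod_apply] using this
    have h2 := isCM_prod (Finset.range (q + 1)) fun i _ =>
      isCM_inv_factoredPoly_div_add ha₀ hb₀ ha hb hba hab
        (show (0 : ℝ) ≤ n + i by positivity)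
    convert h1.mul h2 using 1
    funext m
    simp only [Pi.mul_apply, Finset.prod_apply, add_assoc]
  · rw [completelyMonotoneSeq_iff_isCM]
    refine not_isCM_sub_indicator ?_ hε
    fin_cases j
    · have h := tendsto_negDiff_pow_prod (one_div_pos.2 hb₀).le b hb
      simp only [← one_div_factoredPoly] at h
      simpa using h
    · have h := tendsto_negDiff_pow_prod (one_div_pos.2 (hApos 0)).le
        (fun _ : Fin 1 => factoredPoly b₀ b (0 : ℕ) / factoredPoly a₀ a (0 : ℕ))
        fun _ => div_pos (hBpos 0) (hApos 0)
      convert h using 4 with N l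
      have h1 := hApos 0
      have h2 := hBpos 0
      simp only [Nat.cast_zero] at h1 h2
      simp
      field_simp
      ring

/-- Joint complete monotonicity forces the quotient `b / a` to increase on the whole half-line,
not only along the integers. For large `n` the reciprocal `1 / (b / a + n)` is a multiplier, so
the functions `1 / a * ∏ 1 / (b / a + n + i)`, completely monotone along the integers, are antitone;
long products retain only the monotonicity of `b / a`. -/
theorem prod_div_monotone_of_jointCompletelyMonotone {k : ℕ} {a₀ b₀ : ℝ} (ha₀ : 0 < a₀)
    (hb₀ : 0 < b₀) {a b : Fin k → ℝ} (ha : ∀ j, 0 < a j) (hb : ∀ j, 0 < b j)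
    (h : JointCompletelyMonotone fun α : Fin 2 → ℕ =>
      1 / (factoredPoly b₀ b (α 0) + factoredPoly a₀ a (α 0) * (α 1))) :
    Monotone fun x : ℝ≥0 => ∏ j, ((x : ℝ) + b j) / (x + a j) := by
  have hApos : ∀ x : ℝ≥0, 0 < factoredPoly a₀ a x := fun x => factoredPoly_pos ha₀ ha x.2
  have hBpos : ∀ x : ℝ≥0, 0 < factoredPoly b₀ b x := fun x => factoredPoly_pos hb₀ hb x.2
  set r : ℝ≥0 → ℝ := fun x => factoredPoly b₀ b x / factoredPoly a₀ a x with hr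
  have hrpos : ∀ x, 0 < r x := fun x => div_pos (hBpos x) (hApos x)
  have hrmul : IsMultiplier r := by
    simp only [hr, factoredPoly_div]
    refine (isMultiplier_const _).mul (isMultiplier_prod _ fun j _ => ?_)
    have := (isMultiplier_const 1).add
      ((isMultiplier_const (b j - a j)).mul (isMultiplier_inv_add (ha j)))
    convert this using 2 with x
    have : (x : ℝ) + a j ≠ 0 := (add_pos_of_nonneg_of_pos x.2 (ha j)).ne'
    field_simp
    ring
  have hAmul : IsMultiplier fun x => 1 / factoredPoly a₀ a x := by
    simp only [one_div_factoredPoly]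
    exact (isMultiplier_const _).mul (isMultiplier_prod _ fun j _ => isMultiplier_inv_add (ha j))
  obtain ⟨C, hC⟩ := hrmul.eventually_inv_add hrpos
  obtain ⟨n, hn⟩ := exists_nat_ge C
  have hcm := (jointCompletelyMonotone_one_div_iff (fun m => hApos m) (fun m => hBpos m)).1 h
  have hanti : ∀ q : ℕ, Antitone fun x : ℝ≥0 =>
      1 / factoredPoly a₀ a x * ∏ i ∈ Finset.range (q + 1), (r x + n + i)⁻¹ := by
    intro q
    refine IsMultiplier.antitone_of_isCM (hAmul.mul (isMultiplier_prod _ fun i _ => ?_)) ?_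
    · simp only [add_assoc]
      exact hC _ (hn.trans (le_add_of_nonneg_right i.cast_nonneg))
    · exact hcm q n
  have hmono : Monotone r := fun x y hxy => by
    have := le_of_forall_prod_inv_le (add_pos_of_pos_of_nonneg (hrpos y) n.cast_nonneg)
      (one_div_pos.2 (hApos y)) fun q => hanti q hxy
    linarith
  intro x y hxy
  have := hmono hxy
  simp only [hr, factoredPoly_div] at this
  exact le_of_mul_le_mul_left this (div_pos hb₀ ha₀)

theorem means_le_of_prod_div_monotone {k : ℕ} {a b : Fin k → ℝ} (ha : ∀ j, 0 < a j)
    (hb : ∀ j, 0 < b j)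
    (hmono : Monotone fun x : ℝ≥0 => ∏ j, ((x : ℝ) + b j) / (x + a j)) :
    ∑ j, 1 / a j ≤ ∑ j, 1 / b j ∧ ∏ j, b j ≤ ∏ j, a j ∧ ∑ j, b j ≤ ∑ j, a j := by
  have hlim : Tendsto (fun x : ℝ≥0 => ∏ j, ((x : ℝ) + b j) / (x + a j)) atTop (𝓝 1) := by
    rw [← Finset.prod_const_one (s := (Finset.univ : Finset (Fin k)))]
    refine tendsto_finsetProd _ fun j _ => ?_
    have h1 : Tendsto (fun x : ℝ≥0 => 1 + (b j - a j) * ((x : ℝ) + a j)⁻¹) atTop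
        (𝓝 (1 + (b j - a j) * 0)) :=
      ((tendsto_inv_atTop_zero.comp
        (tendsto_atTop_add_const_right _ (a j) (NNReal.tendsto_coe_atTop.2 tendsto_id))).const_mul
          _).const_add _
    rw [mul_zero, add_zero] at h1
    refine h1.congr fun x => ?_
    have : (x : ℝ) + a j ≠ 0 := (add_pos_of_nonneg_of_pos x.2 (ha j)).ne'
    field_simp
    ring
  have hle : ∀ x : ℝ, 0 ≤ x → ∏ j, (x + b j) ≤ ∏ j, (x + a j) := by
    intro x hx
    lift x to ℝ≥0 using hx
    have h1 := hmono.ge_of_tendsto hlim x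
    simp only [Finset.prod_div_distrib] at h1
    exact (div_le_one (Finset.prod_pos fun j _ => add_pos_of_nonneg_of_pos x.2 (ha j))).1 h1
  refine ⟨sum_le_sum_of_prod_one_add_mul_le fun y hy => ?_, by simpa using hle 0 le_rfl,
    sum_le_sum_of_prod_one_add_mul_le fun y hy => ?_⟩
  · lift y to ℝ≥0 using hy.le
    have h1 := hmono (zero_le : 0 ≤ y)
    simp only [NNReal.coe_zero, zero_add] at h1
    have h2 : ∀ j, 1 + 1 / b j * (y : ℝ)
        = (b j / a j)⁻¹ * ((y + b j) / (y + a j)) * ((y + a j) / a j) := by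
      intro j
      have := ha j
      have := hb j
      field_simp
      ring
    have h3 : ∀ j, 1 + 1 / a j * (y : ℝ) = (y + a j) / a j := by
      intro j
      have := ha j
      field_simp
      ring
    simp only [h2, h3]
    rw [Finset.prod_mul_distrib, Finset.prod_mul_distrib, Finset.prod_inv_distrib]
    refine le_mul_of_one_le_left (Finset.prod_nonneg fun j _ =>
      (div_pos (add_pos hy (ha j)) (ha j)).le) ?_
    rwa [← div_eq_inv_mul, one_le_div (Finset.prod_pos fun j _ => div_pos (hb j) (ha j))]
  · have h1 := hle y⁻¹ (inv_nonneg.2 hy.le)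
    have h2 : ∀ s : ℝ, 1 + s * y = y * (y⁻¹ + s) := by
      intro s
      field_simp
    simp only [h2, Finset.prod_mul_distrib]
    exact mul_le_mul_of_nonneg_left h1 (Finset.prod_nonneg fun _ _ => hy.le)

/-- The entries `a_1, …, a_k` and `b_1, …, b_k` are `a 0, …, a (k - 1)` and `b 0, …, b (k - 1)`,
and the pair `(m, n)` is the multi-index `α` with `α 0 = m` and `α 1 = n`. -/
theorem theorem1p4 (k : ℕ) (a₀ b₀ : ℝ) (ha₀ : 0 < a₀) (hb₀ : 0 < b₀)
    (a b : Fin k → ℝ) (ha : ∀ j, 0 < a j) (hb : ∀ j, 0 < b j) :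
    (((∀ j : Fin k, b j ≤ a j) ∧ (∀ i j : Fin k, (i : ℕ) + 1 = (j : ℕ) → a i ≤ b j)) →
      MinimalJointCompletelyMonotone fun α : Fin 2 → ℕ =>
        1 / (factoredPoly b₀ b (α 0) + factoredPoly a₀ a (α 0) * (α 1))) ∧
    ((JointCompletelyMonotone fun α : Fin 2 → ℕ =>
        1 / (factoredPoly b₀ b (α 0) + factoredPoly a₀ a (α 0) * (α 1))) →
      ∑ j, 1 / a j ≤ ∑ j, 1 / b j ∧
      ∏ j, b j ≤ ∏ j, a j ∧
      ∑ j, b j ≤ ∑ j, a j) := by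
  exact ⟨fun h => minimalJointCompletelyMonotone_of_interlacing ha₀ hb₀ ha hb h.1 h.2,
    fun h => means_le_of_prod_div_monotone ha hb
      (prod_div_monotone_of_jointCompletelyMonotone ha₀ hb₀ ha hb h)⟩
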